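/- For positive integers $k_1,\dots,k_r$ with $k_1\ge 2$, let $$\zeta(k_1,\dots,k_r)=\sum_{n_1>\cdots>n_r>0}\frac{1}{n_1^{k_1}\cdots n_r^{k_r}},\qquad T(k_1,\dots,k_r)=\sum_{\substack{n_1>\cdots>n_r>0\\ n_j\equiv r+1-j\ (\mathrm{mod}\ 2)\ \forall j}}\frac{2^r}{n_1^{k_1}\cdots n_r^{k_r}}$$ denote the multiple zeta values and the (Kaneko--Tsumura) multiple $T$-values. Then for all integers $q\ge 1$, $p\ge 2$ and $m\ge 2$, $$\sum_{\substack{i+j=m-1\\ i,j\ge 0}}\binom{p+i-1}{i}\binom{q+j-1}{j}\zeta(p+i,q+j)-(-1)^q\sum_{\substack{i+j=p-1\\ i,j\ge 0}}\binom{m+i-1}{i}\binom{q+j-1}{j}\zeta(m+i,q+j)$$ $$=\sum_{\substack{i+j=q-1\\ i,j\ge 0}}(-1)^j\binom{m+i-1}{i}\binom{p+j-1}{j}\zeta(m+i)\zeta(p+j),$$ and $$\sum_{\substack{i+j=m-1\\ i,j\ge 0}}\binom{p+i-1}{i}\binom{q+j-1}{j}T(p+i,q+j)-(-1)^q\sum_{\substack{i+j=p-1\\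 i,j\ge 0}}\binom{m+i-1}{i}\binom{q+j-1}{j}T(m+i,q+j)$$ $$=\sum_{\substack{i+j=q-1\\ i,j\ge 0}}(-1)^j\binom{m+i-1}{i}\binom{p+j-1}{j}T(m+i)T(p+j).$$ -/

import Mathlib

/-- The multiple zeta value
`ζ(k₁, …, k_r) = ∑_{n₁ > ⋯ > n_r > 0} 1 / (n₁ ^ k₁ ⋯ n_r ^ k_r)`.
The index `j : Fin r` is the zero-based version of `j + 1 ∈ {1, …, r}`.  All terms are nonnegative,
and the series converges for positive integers `k₁, …, k_r` with `k₁ ≥ 2`. -/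
noncomputable def multipleZetaValue {r : ℕ} (k : Fin r → ℕ) : ℝ :=
  ∑' n : {n : Fin r → ℕ // StrictAnti n ∧ ∀ j, 0 < n j},
    ∏ j, 1 / (n.1 j : ℝ) ^ k j

/-- The (Kaneko–Tsumura) multiple `T`-value
`T(k₁, …, k_r) = ∑ 2 ^ r / (n₁ ^ k₁ ⋯ n_r ^ k_r)`, the sum being over all `n₁ > ⋯ > n_r > 0` with
`n_j ≡ r + 1 - j` modulo `2` for all `j`.
The index `j : Fin r` is the zero-based version of `j + 1 ∈ {1, …, r}`, so the congruence reads
`n j ≡ r - j`.  All terms are nonnegative, and the series converges for positive integers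
`k₁, …, k_r` with `k₁ ≥ 2`. -/
noncomputable def multipleTValue {r : ℕ} (k : Fin r → ℕ) : ℝ :=
  ∑' n : {n : Fin r → ℕ // StrictAnti n ∧ (∀ j, 0 < n j) ∧
      ∀ j : Fin r, n j ≡ r - (j : ℕ) [MOD 2]},
    2 ^ r * ∏ j, 1 / (n.1 j : ℝ) ^ k j

/-! Both formulas are one partial fraction identity in x = n₂ and y = n₁ - n₂, summed over a set of
pairs symmetric in x and y. The rational function t⁻ᵐ (x + y - t)⁻ᵖ (x - t)⁻ᵠ has poles at 0, x + y
and x, and its residues sum to zero; reading them off as coefficients gives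
`partial_fraction_identity`. The vanishing is proved algebraically, by induction on m and q from x =
t + (x - t). Taking x, y in D, all positive integers for ζ and the odd ones for T,
`weighted_sum_formula` sums the identity over D × D. -/

/-- The expansion of `(u - X)⁻ᵖ` in powers of `X`. -/
noncomputable def negPowSeries (u : ℝ) (p : ℕ) : PowerSeries ℝ :=
  PowerSeries.mk fun i => ((p + i - 1).choose i : ℝ) * (1 / u ^ (p + i))

/-- Truncated subtraction is harmless here: for i ≥ 1 the coefficient is (i - 1).choose i = 0. -/
lemma negPowSeries_zero (u : ℝ) : negPowSeries u 0 = 1 := by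
  ext i
  rcases i with _ | i
  · simp [negPowSeries]
  · simp [negPowSeries, PowerSeries.coeff_one]

/-- This is (u - X)(u - X)⁻⁽ᵖ⁺¹⁾ = (u - X)⁻ᵖ; on coefficients it is Pascal's rule. -/
lemma smul_negPowSeries_succ {u : ℝ} (hu : u ≠ 0) (p : ℕ) :
    PowerSeries.C u * negPowSeries u (p + 1) =
      negPowSeries u p + PowerSeries.X * negPowSeries u (p + 1) := by
  ext i
  rw [PowerSeries.coeff_C_mul, map_add]
  rcases i with _ | i
  · simp [negPowSeries]
    field_simp
    rw [pow_succ']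
  · rw [PowerSeries.coeff_succ_X_mul]
    simp only [negPowSeries, PowerSeries.coeff_mk]
    have h1 : p + 1 + (i + 1) - 1 = (p + i) + 1 := by omega
    have h2 : p + (i + 1) - 1 = p + i := by omega
    have h3 : p + 1 + i - 1 = p + i := by omega
    rw [h1, h2, h3, Nat.choose_succ_succ]
    push_cast
    field_simp
    ring

/-! ### Vanishing of the residue sum -/

/-- The sum of the residues of `t⁻ᵐ (x + y - t)⁻ᵖ (x - t)⁻ᵠ`, up to sign. -/
noncomputable def residueSum (x y : ℝ) (p m q : ℕ) : ℝ :=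
  PowerSeries.coeff m (PowerSeries.X * (negPowSeries (x + y) p * negPowSeries x q))
    - (-1) ^ q *
      PowerSeries.coeff p (PowerSeries.X * (negPowSeries (x + y) m * negPowSeries y q))
    - (-1) ^ p *
      PowerSeries.coeff q (PowerSeries.X * (negPowSeries x m * negPowSeries (-y) p))

/-- Writing x = t + (x - t) cancels one factor of t or of x - t. The relation holds separately at
each pole. The factor `X` in `residueSum` makes the coefficient 0 when the exponent of the pole is
0, so no boundary case arises. -/
lemma mul_residueSum_succ_succ {x y : ℝ} (hx : x ≠ 0) (hy : y ≠ 0) (hxy : x + y ≠ 0)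
    (p m q : ℕ) :
    x * residueSum x y p (m + 1) (q + 1) =
      residueSum x y p (m + 1) q + residueSum x y p m (q + 1) := by
  have ex := smul_negPowSeries_succ hx
  have ey := smul_negPowSeries_succ hy q
  have en := smul_negPowSeries_succ hxy m
  have h1 : x * PowerSeries.coeff (m + 1) (PowerSeries.X *
        (negPowSeries (x + y) p * negPowSeries x (q + 1))) =
      PowerSeries.coeff (m + 1) (PowerSeries.X * (negPowSeries (x + y) p * negPowSeries x q)) +
      PowerSeries.coeff m (PowerSeries.X *
        (negPowSeries (x + y) p * negPowSeries x (q + 1))) := by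
    rw [← PowerSeries.coeff_succ_X_mul m (PowerSeries.X * _), ← PowerSeries.coeff_C_mul, ← map_add]
    congr 1
    linear_combination (PowerSeries.X * negPowSeries (x + y) p) * ex q
  -- At the pole x + y, use x = (x + y) - y; the two `X` terms cancel.
  have h2 : x * PowerSeries.coeff p (PowerSeries.X *
        (negPowSeries (x + y) (m + 1) * negPowSeries y (q + 1))) =
      PowerSeries.coeff p (PowerSeries.X * (negPowSeries (x + y) m * negPowSeries y (q + 1))) -
      PowerSeries.coeff p (PowerSeries.X *
        (negPowSeries (x + y) (m + 1) * negPowSeries y q)) := by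
    rw [← PowerSeries.coeff_C_mul, ← map_sub]
    congr 1
    rw [map_add] at en
    linear_combination (PowerSeries.X * negPowSeries y (q + 1)) * en -
      (PowerSeries.X * negPowSeries (x + y) (m + 1)) * ey
  have h3 : x * PowerSeries.coeff (q + 1) (PowerSeries.X *
        (negPowSeries x (m + 1) * negPowSeries (-y) p)) =
      PowerSeries.coeff (q + 1) (PowerSeries.X * (negPowSeries x m * negPowSeries (-y) p)) +
      PowerSeries.coeff q (PowerSeries.X *
        (negPowSeries x (m + 1) * negPowSeries (-y) p)) := by
    rw [← PowerSeries.coeff_succ_X_mul q (PowerSeries.X * _), ← PowerSeries.coeff_C_mul, ← map_add]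
    congr 1
    linear_combination (PowerSeries.X * negPowSeries (-y) p) * ex m
  unfold residueSum
  rw [mul_sub, mul_sub, mul_left_comm x, mul_left_comm x, h1, h2, h3]
  ring

lemma choose_add_symm (a b : ℕ) : (a + 1 + b - 1).choose b = (b + 1 + a - 1).choose a := by
  rw [show a + 1 + b - 1 = a + b by omega, show b + 1 + a - 1 = a + b by omega]
  exact Nat.choose_symm_add.symm

/-- With no pole at 0, the residues at x + y and x are the same binomial multiple of a power of y,
with opposite signs. -/
lemma residueSum_zero_left {y : ℝ} (x : ℝ) (p q : ℕ) :
    residueSum x y (p + 1) 0 (q + 1) = 0 := by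
  simp only [residueSum, PowerSeries.coeff_zero_X_mul, negPowSeries_zero, one_mul,
    PowerSeries.coeff_succ_X_mul]
  simp only [negPowSeries, PowerSeries.coeff_mk]
  rw [choose_add_symm p q, show p + 1 + q = q + 1 + p by omega, neg_pow y]
  have h : ((-1 : ℝ) ^ (q + 1 + p))⁻¹ = (-1) ^ (q + 1 + p) := by
    rw [← inv_pow]; norm_num
  rw [one_div, one_div, mul_inv, h]
  have hp : ((-1 : ℝ) ^ p) ^ 2 = 1 := by rw [← pow_mul, mul_comm, pow_mul]; simp
  rw [show q + 1 + p - 1 = q + p by omega]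
  linear_combination -(-1 : ℝ) ^ q * ((q + p).choose p : ℝ) * (y ^ (q + 1 + p))⁻¹ * hp

lemma residueSum_zero_right {x y : ℝ} (p m : ℕ) :
    residueSum x y (p + 1) (m + 1) 0 = 0 := by
  simp only [residueSum, PowerSeries.coeff_zero_X_mul, negPowSeries_zero, mul_one,
    PowerSeries.coeff_succ_X_mul]
  simp only [negPowSeries, PowerSeries.coeff_mk]
  rw [choose_add_symm p m, show p + 1 + m = m + 1 + p by omega]
  ring

lemma residueSum_eq_zero {x y : ℝ} (hx : x ≠ 0) (hy : y ≠ 0) (hxy : x + y ≠ 0) (p m q : ℕ) :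
    residueSum x y (p + 1) m (q + 1) = 0 := by
  induction m generalizing q with
  | zero => exact residueSum_zero_left x p q
  | succ m ihm =>
    -- For fixed m, the recurrence and the hypothesis on m raise q by one; x ≠ 0 allows division.
    have step (q : ℕ) (h : residueSum x y (p + 1) (m + 1) q = 0) :
        residueSum x y (p + 1) (m + 1) (q + 1) = 0 := by
      have := mul_residueSum_succ_succ hx hy hxy (p + 1) m q
      rw [h, ihm, add_zero] at this
      exact (mul_eq_zero.mp this).resolve_left hx
    induction q with
    | zero => exact step 0 (residueSum_zero_right p m)
    | succ q ihq => exact step (q + 1) ihq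

/-- The partial fraction decomposition underlying the weighted sum formulas. -/
lemma partial_fraction_identity {x y : ℝ} (hx : x ≠ 0) (hy : y ≠ 0) (hxy : x + y ≠ 0)
    {p m q : ℕ} (hp : 1 ≤ p) (hm : 1 ≤ m) (hq : 1 ≤ q) :
    ∑ ij ∈ Finset.HasAntidiagonal.antidiagonal (m - 1),
        ((p + ij.1 - 1).choose ij.1 : ℝ) * ((q + ij.2 - 1).choose ij.2 : ℝ) *
          (1 / (x + y) ^ (p + ij.1) * (1 / x ^ (q + ij.2)))
      - (-1 : ℝ) ^ q * ∑ ij ∈ Finset.HasAntidiagonal.antidiagonal (p - 1),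
        ((m + ij.1 - 1).choose ij.1 : ℝ) * ((q + ij.2 - 1).choose ij.2 : ℝ) *
          (1 / (x + y) ^ (m + ij.1) * (1 / y ^ (q + ij.2)))
    = ∑ ij ∈ Finset.HasAntidiagonal.antidiagonal (q - 1),
        (-1 : ℝ) ^ ij.2 * ((m + ij.1 - 1).choose ij.1 : ℝ) * ((p + ij.2 - 1).choose ij.2 : ℝ) *
          (1 / x ^ (m + ij.1) * (1 / y ^ (p + ij.2))) := by
  obtain ⟨p, rfl⟩ := Nat.exists_eq_add_of_le' hp
  obtain ⟨m, rfl⟩ := Nat.exists_eq_add_of_le' hm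
  obtain ⟨q, rfl⟩ := Nat.exists_eq_add_of_le' hq
  have h := residueSum_eq_zero hx hy hxy p (m + 1) q
  simp only [residueSum, PowerSeries.coeff_succ_X_mul] at h
  rw [sub_eq_zero] at h
  simp only [PowerSeries.coeff_mul] at h
  simp only [Nat.add_sub_cancel]
  convert h using 1
  · congr 1
    · refine Finset.sum_congr rfl fun ij _ => ?_
      simp only [negPowSeries, PowerSeries.coeff_mk]
      ring
    · congr 1
      refine Finset.sum_congr rfl fun ij _ => ?_
      simp only [negPowSeries, PowerSeries.coeff_mk]
      ring
  · rw [Finset.mul_sum]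
    refine Finset.sum_congr rfl fun ij _ => ?_
    simp only [negPowSeries, PowerSeries.coeff_mk]
    have h : (-1 : ℝ) ^ (p + 1) * (1 / (-y) ^ (p + 1 + ij.2)) =
        (-1) ^ ij.2 * (1 / y ^ (p + 1 + ij.2)) := by
      rw [neg_pow y, one_div, mul_inv, ← inv_pow, show (-1 : ℝ)⁻¹ = -1 by norm_num, ← mul_assoc,
        pow_add (-1 : ℝ) (p + 1) ij.2, ← mul_assoc, ← pow_add (-1 : ℝ) (p + 1),
        Even.neg_one_pow ⟨p + 1, rfl⟩, one_mul, one_div]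
    linear_combination (-((m + 1 + ij.1 - 1).choose ij.1 : ℝ) *
      ((p + 1 + ij.2 - 1).choose ij.2 : ℝ) * (1 / x ^ (m + 1 + ij.1))) * h

/-! ### Summation over pairs -/

section RestrictedSums

variable {D : Set ℕ}

lemma summable_one_div_pow_subtype (D : Set ℕ) {a : ℕ} (ha : 2 ≤ a) :
    Summable fun x : D => 1 / ((x : ℕ) : ℝ) ^ a :=
  (Real.summable_one_div_nat_pow.mpr ha).subtype D

lemma summable_one_div_add_pow_mul (hD : ∀ x ∈ D, 0 < x) {a b : ℕ} (ha : 2 ≤ a) (hb : 1 ≤ b) :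
    Summable fun z : D × D =>
      1 / (((z.1 : ℕ) : ℝ) + ((z.2 : ℕ) : ℝ)) ^ a * (1 / ((z.1 : ℕ) : ℝ) ^ b) := by
  -- The bound (x + y)² x ≥ x^(3/2) y^(3/2) shares the total degree 3 equally, leaving an exponent
  -- above 1 in each variable.
  have hs : Summable fun x : D => 1 / ((x : ℕ) : ℝ) ^ (3 / 2 : ℝ) :=
    (Real.summable_one_div_nat_rpow.mpr (by norm_num : (1 : ℝ) < 3 / 2)).subtype D
  have hs2 := hs.mul_of_nonneg hs (fun x => by positivity) (fun x => by positivity)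
  refine hs2.of_nonneg_of_le (fun z => by positivity) fun z => ?_
  have hx : (1 : ℝ) ≤ ((z.1 : ℕ) : ℝ) := by exact_mod_cast hD _ z.1.2
  have hy : (1 : ℝ) ≤ ((z.2 : ℕ) : ℝ) := by exact_mod_cast hD _ z.2.2
  generalize ((z.1 : ℕ) : ℝ) = x at hx ⊢
  generalize ((z.2 : ℕ) : ℝ) = y at hy ⊢
  have hx0 : 0 < x := by linarith
  have hy0 : 0 < y := by linarith
  rw [one_div_mul_one_div, one_div_mul_one_div]
  apply one_div_le_one_div_of_le (by positivity)
  calc x ^ (3 / 2 : ℝ) * y ^ (3 / 2 : ℝ)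
      = x ^ (1 / 2 : ℝ) * y ^ (3 / 2 : ℝ) * x := by
        rw [show (3 / 2 : ℝ) = 1 / 2 + 1 by norm_num, Real.rpow_add hx0, Real.rpow_one]; ring
    _ ≤ (x + y) ^ (1 / 2 : ℝ) * (x + y) ^ (3 / 2 : ℝ) * x := by
        gcongr <;> linarith
    _ = (x + y) ^ 2 * x ^ 1 := by
        rw [← Real.rpow_add (by positivity), pow_one]; norm_num
    _ ≤ (x + y) ^ a * x ^ b := by
        gcongr
        linarith

/-- The weighted sum formula for sums restricted to a set `D` of positive integers. -/
lemma weighted_sum_formula (hD : ∀ x ∈ D, 0 < x) {p m q : ℕ} (hq : 1 ≤ q) (hp : 2 ≤ p)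
    (hm : 2 ≤ m) (Z : ℕ → ℝ) (W : ℕ → ℕ → ℝ) (c : ℝ)
    (hZ : ∀ a, Z a = c * ∑' x : D, 1 / ((x : ℕ) : ℝ) ^ a)
    (hW : ∀ a b, W a b = c ^ 2 * ∑' z : D × D,
      1 / (((z.1 : ℕ) : ℝ) + ((z.2 : ℕ) : ℝ)) ^ a * (1 / ((z.1 : ℕ) : ℝ) ^ b)) :
    ∑ ij ∈ Finset.HasAntidiagonal.antidiagonal (m - 1),
        ((p + ij.1 - 1).choose ij.1 : ℝ) * ((q + ij.2 - 1).choose ij.2 : ℝ) *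
          W (p + ij.1) (q + ij.2)
      - (-1 : ℝ) ^ q * ∑ ij ∈ Finset.HasAntidiagonal.antidiagonal (p - 1),
        ((m + ij.1 - 1).choose ij.1 : ℝ) * ((q + ij.2 - 1).choose ij.2 : ℝ) *
          W (m + ij.1) (q + ij.2)
    = ∑ ij ∈ Finset.HasAntidiagonal.antidiagonal (q - 1),
        (-1 : ℝ) ^ ij.2 * ((m + ij.1 - 1).choose ij.1 : ℝ) * ((p + ij.2 - 1).choose ij.2 : ℝ) *
          (Z (m + ij.1) * Z (p + ij.2)) := by
  have hW1 (a b : ℕ) (ha : 2 ≤ a) (hb : 1 ≤ b) : HasSum (fun z : D × D => c ^ 2 *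
      (1 / (((z.1 : ℕ) : ℝ) + ((z.2 : ℕ) : ℝ)) ^ a * (1 / ((z.1 : ℕ) : ℝ) ^ b))) (W a b) := by
    rw [hW]
    exact (summable_one_div_add_pow_mul hD ha hb).hasSum.mul_left _
  have hW2 (a b : ℕ) (ha : 2 ≤ a) (hb : 1 ≤ b) : HasSum (fun z : D × D => c ^ 2 *
      (1 / (((z.1 : ℕ) : ℝ) + ((z.2 : ℕ) : ℝ)) ^ a * (1 / ((z.2 : ℕ) : ℝ) ^ b))) (W a b) := by
    -- Swapping x and y preserves D × D, so the sum with y in place of x has the same value.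
    have h := (Equiv.prodComm D D).hasSum_iff.mpr (hW1 a b ha hb)
    refine h.congr_fun ?_
    intro z
    simp [add_comm]
  have hZZ (a b : ℕ) (ha : 2 ≤ a) (hb : 2 ≤ b) : HasSum (fun z : D × D => c ^ 2 *
      (1 / ((z.1 : ℕ) : ℝ) ^ a * (1 / ((z.2 : ℕ) : ℝ) ^ b))) (Z a * Z b) := by
    have sa := summable_one_div_pow_subtype D ha
    have sb := summable_one_div_pow_subtype D hb
    have h := (sa.hasSum.mul sb.hasSum (sa.mul_of_nonneg sb (fun x => by positivity)
      (fun x => by positivity))).mul_left (c ^ 2)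
    rw [hZ, hZ, mul_mul_mul_comm, ← pow_two]
    exact h
  have H1 := hasSum_sum (s := Finset.HasAntidiagonal.antidiagonal (m - 1)) fun ij _ =>
    (hW1 (p + ij.1) (q + ij.2) (by omega) (by omega)).mul_left
      (((p + ij.1 - 1).choose ij.1 : ℝ) * ((q + ij.2 - 1).choose ij.2 : ℝ))
  have H2 := (hasSum_sum (s := Finset.HasAntidiagonal.antidiagonal (p - 1)) fun ij _ =>
    (hW2 (m + ij.1) (q + ij.2) (by omega) (by omega)).mul_left
      (((m + ij.1 - 1).choose ij.1 : ℝ) * ((q + ij.2 - 1).choose ij.2 : ℝ))).mul_left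
      ((-1 : ℝ) ^ q)
  have H3 := hasSum_sum (s := Finset.HasAntidiagonal.antidiagonal (q - 1)) fun ij _ =>
    (hZZ (m + ij.1) (p + ij.2) (by omega) (by omega)).mul_left
      ((-1 : ℝ) ^ ij.2 * ((m + ij.1 - 1).choose ij.1 : ℝ) * ((p + ij.2 - 1).choose ij.2 : ℝ))
  refine (H1.sub H2).unique (H3.congr_fun fun z => ?_)
  have hx : (0 : ℝ) < ((z.1 : ℕ) : ℝ) := by exact_mod_cast hD _ z.1.2
  have hy : (0 : ℝ) < ((z.2 : ℕ) : ℝ) := by exact_mod_cast hD _ z.2.2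
  simp only [mul_left_comm _ (c ^ 2), ← Finset.mul_sum]
  rw [← mul_sub, partial_fraction_identity hx.ne' hy.ne' (by positivity)
    (by omega) (by omega) hq]

end RestrictedSums

/-! ### Zeta and T-values as sums over pairs -/

/-- Pairs `n₁ > n₂` with `n₁ - n₂` and `n₂` in `D`, parametrised by `(n₂, n₁ - n₂)`. -/
def strictAntiPairEquiv (D : Set ℕ) (Q : (Fin 2 → ℕ) → Prop)
    (hQ : ∀ n, Q n ↔ n 1 < n 0 ∧ n 1 ∈ D ∧ n 0 - n 1 ∈ D) (hD : ∀ x ∈ D, 0 < x) :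
    D × D ≃ {n : Fin 2 → ℕ // Q n} where
  toFun z := ⟨![z.1 + z.2, z.1], (hQ _).2 ⟨by simpa using hD _ z.2.2, by simp, by simp⟩⟩
  invFun n := (⟨n.1 1, ((hQ _).1 n.2).2.1⟩, ⟨n.1 0 - n.1 1, ((hQ _).1 n.2).2.2⟩)
  left_inv z := by ext <;> simp
  right_inv n := by
    have h := ((hQ _).1 n.2).1
    ext j
    fin_cases j
    · simp; omega
    · simp

lemma strictAnti_fin_two_iff (n : Fin 2 → ℕ) : StrictAnti n ↔ n 1 < n 0 := by
  constructor
  · intro h; exact h (by decide)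
  · intro h i j hij
    fin_cases i <;> fin_cases j <;> simp_all

lemma strictAnti_fin_one (n : Fin 1 → ℕ) : StrictAnti n := fun i j hij =>
  absurd hij (by simp [Subsingleton.elim i j])

lemma multipleZetaValue_one (a : ℕ) :
    multipleZetaValue ![a] = 1 * ∑' x : {x : ℕ | 0 < x}, 1 / ((x : ℕ) : ℝ) ^ a := by
  rw [one_mul, multipleZetaValue]
  let e : {x : ℕ | 0 < x} ≃ {n : Fin 1 → ℕ // StrictAnti n ∧ ∀ j, 0 < n j} :=
    (Equiv.funUnique (Fin 1) ℕ).symm.subtypeEquiv fun x => by simp [strictAnti_fin_one]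
  rw [← e.tsum_eq]
  simp [e]

lemma multipleZetaValue_two (a b : ℕ) :
    multipleZetaValue ![a, b] = 1 ^ 2 * ∑' z : {x : ℕ | 0 < x} × {x : ℕ | 0 < x},
      1 / (((z.1 : ℕ) : ℝ) + ((z.2 : ℕ) : ℝ)) ^ a * (1 / ((z.1 : ℕ) : ℝ) ^ b) := by
  rw [one_pow, one_mul, multipleZetaValue, ← (strictAntiPairEquiv {x : ℕ | 0 < x} _ (fun n => by
    rw [strictAnti_fin_two_iff, Fin.forall_fin_two]
    simp only [Set.mem_ofPred_eq]
    omega) fun _ h => h).tsum_eq]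
  simp [strictAntiPairEquiv, mul_comm]

lemma multipleTValue_one (a : ℕ) :
    multipleTValue ![a] = 2 * ∑' x : {x : ℕ | Odd x}, 1 / ((x : ℕ) : ℝ) ^ a := by
  rw [multipleTValue, tsum_mul_left]
  let e : {x : ℕ | Odd x} ≃ {n : Fin 1 → ℕ // StrictAnti n ∧ (∀ j, 0 < n j) ∧
      ∀ j : Fin 1, n j ≡ 1 - (j : ℕ) [MOD 2]} :=
    (Equiv.funUnique (Fin 1) ℕ).symm.subtypeEquiv fun x => by
      simp [strictAnti_fin_one, Nat.ModEq, Nat.odd_iff]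
      omega
  rw [← e.tsum_eq]
  simp [e]

/-- For n₁ > n₂, the conditions n₁ even and n₂ odd say exactly that n₂ and n₁ - n₂ are both odd. -/
lemma multipleTValue_two (a b : ℕ) :
    multipleTValue ![a, b] = 2 ^ 2 * ∑' z : {x : ℕ | Odd x} × {x : ℕ | Odd x},
      1 / (((z.1 : ℕ) : ℝ) + ((z.2 : ℕ) : ℝ)) ^ a * (1 / ((z.1 : ℕ) : ℝ) ^ b) := by
  rw [multipleTValue, tsum_mul_left, ← (strictAntiPairEquiv {x : ℕ | Odd x} _ (fun n => by
    rw [strictAnti_fin_two_iff, Fin.forall_fin_two, Fin.forall_fin_two]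
    simp only [Set.mem_ofPred_eq, Nat.odd_iff, Nat.ModEq, Fin.val_zero, Fin.val_one]
    omega) fun _ h => h.pos).tsum_eq]
  simp [strictAntiPairEquiv, mul_comm]

theorem mainTheorem3 (q p m : ℕ) (hq : 1 ≤ q) (hp : 2 ≤ p) (hm : 2 ≤ m) :
    (∑ ij ∈ Finset.HasAntidiagonal.antidiagonal (m - 1),
          ((p + ij.1 - 1).choose ij.1 : ℝ) * ((q + ij.2 - 1).choose ij.2 : ℝ) *
            multipleZetaValue ![p + ij.1, q + ij.2]
        - (-1 : ℝ) ^ q * ∑ ij ∈ Finset.HasAntidiagonal.antidiagonal (p - 1),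
          ((m + ij.1 - 1).choose ij.1 : ℝ) * ((q + ij.2 - 1).choose ij.2 : ℝ) *
            multipleZetaValue ![m + ij.1, q + ij.2]
      = ∑ ij ∈ Finset.HasAntidiagonal.antidiagonal (q - 1),
          (-1 : ℝ) ^ ij.2 * ((m + ij.1 - 1).choose ij.1 : ℝ) * ((p + ij.2 - 1).choose ij.2 : ℝ) *
            (multipleZetaValue ![m + ij.1] * multipleZetaValue ![p + ij.2])) ∧
    (∑ ij ∈ Finset.HasAntidiagonal.antidiagonal (m - 1),
          ((p + ij.1 - 1).choose ij.1 : ℝ) * ((q + ij.2 - 1).choose ij.2 : ℝ) *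
            multipleTValue ![p + ij.1, q + ij.2]
        - (-1 : ℝ) ^ q * ∑ ij ∈ Finset.HasAntidiagonal.antidiagonal (p - 1),
          ((m + ij.1 - 1).choose ij.1 : ℝ) * ((q + ij.2 - 1).choose ij.2 : ℝ) *
            multipleTValue ![m + ij.1, q + ij.2]
      = ∑ ij ∈ Finset.HasAntidiagonal.antidiagonal (q - 1),
          (-1 : ℝ) ^ ij.2 * ((m + ij.1 - 1).choose ij.1 : ℝ) * ((p + ij.2 - 1).choose ij.2 : ℝ) *
            (multipleTValue ![m + ij.1] * multipleTValue ![p + ij.2])) := by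
  exact ⟨weighted_sum_formula (D := {x : ℕ | 0 < x}) (fun _ h => h) hq hp hm
      (fun a => multipleZetaValue ![a]) (fun a b => multipleZetaValue ![a, b]) 1
      multipleZetaValue_one multipleZetaValue_two,
    weighted_sum_formula (D := {x : ℕ | Odd x}) (fun _ h => Odd.pos h) hq hp hm
      (fun a => multipleTValue ![a]) (fun a b => multipleTValue ![a, b]) 2
      multipleTValue_one multipleTValue_two⟩
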